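/- For $n\in\mathbb N=\{0,1,2,\ldots\}$ let $A_n=\sum_{k=0}^{n}\binom{n}{k}^2\binom{n+k}{k}^2$ be the $n$-th Apéry number. For every $r\in\mathbb N$ there is a rational number $c_r$, depending only on $r$ (and not on $p$), whose denominator in lowest terms is a power of $2$ (possibly $1$), such that for every prime $p>3$ the number $c_r$ is a $p$-adic integer and $$\sum_{k=0}^{p-1}(2k+1)^{2r+1}A_k\equiv c_r\,p \pmod{p^3},$$ where the congruence is taken in the ring $\mathbb Z_p$ of $p$-adic integers. -/

import Mathlib

/-- The Apéry numbers. -/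
def aperyNumber (n : ℕ) : ℕ :=
  ∑ k ∈ Finset.range (n + 1), (n.choose k) ^ 2 * ((n + k).choose k) ^ 2

/-! Write S_r(N) for the weighted sum over k < N. Summation by parts against the Apéry recurrence,
tested on x(n) = (2n+1)^(2d), gives a sum divisible by N^3. In m = 2n+1 the resulting weight is an
odd polynomial of degree 2d+3, so 16 S_{d+1} reduces mod N^3 to an integer combination of S_0, ...,
S_d (`exists_oddPowerAperySum_reduction`). Hence 16^r S_r ≡ e S_0, and c_r = e/16^r. It remains that
S_0(p) ≡ p mod p^3 (`oddPowerAperySum_zero_congr`): after exchanging sums, the inner sum is p^2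
v^2/(2k+1) with v^2 ≡ 1 mod p^2. The terms k and p-1-k cancel mod p^3, except the middle one, which
gives p. -/

/-- The product `C(n, k) * C(n + k, k)`, whose squares over `k` sum to the Apéry number. -/
def aperyTerm (n k : ℕ) : ℤ := n.choose k * (n + k).choose k

theorem aperyTerm_zero_right (n : ℕ) : aperyTerm n 0 = 1 := by simp [aperyTerm]

theorem aperyTerm_eq_zero {n k : ℕ} (h : n < k) : aperyTerm n k = 0 := by
  simp [aperyTerm, Nat.choose_eq_zero_of_lt h]

theorem choose_succ_right_int (n k : ℕ) :
    (n.choose (k + 1) : ℤ) * (k + 1) = n.choose k * ((n : ℤ) - k) := by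
  rcases le_or_gt k n with h | h
  · have := Nat.choose_succ_right_eq n k
    zify [h] at this
    exact this
  · simp [Nat.choose_eq_zero_of_lt h, Nat.choose_eq_zero_of_lt (Nat.lt_succ_of_lt h)]

theorem choose_succ_left_int (n k : ℕ) :
    ((n + 1).choose k : ℤ) * ((n : ℤ) + 1 - k) = n.choose k * ((n : ℤ) + 1) := by
  rcases le_or_gt k (n + 1) with h | h
  · have := Nat.choose_mul_succ_eq n k
    zify [h] at this
    linarith
  · simp [Nat.choose_eq_zero_of_lt h, Nat.choose_eq_zero_of_lt (Nat.lt_of_succ_lt h)]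

theorem aperyTerm_succ_right (n k : ℕ) :
    ((k : ℤ) + 1) ^ 2 * aperyTerm n (k + 1) = (n - k) * (n + k + 1) * aperyTerm n k := by
  have h1 := choose_succ_right_int n k
  have h2 := Nat.add_one_mul_choose_eq (n + k) k
  zify at h2
  simp only [aperyTerm, ← add_assoc]
  linear_combination ((k : ℤ) + 1) * ((n + k + 1).choose (k + 1)) * h1
    - ((n.choose k : ℤ) * (n - k)) * h2

theorem aperyTerm_succ_left (n k : ℕ) :
    ((n : ℤ) + 1 - k) * aperyTerm (n + 1) k = (n + 1 + k) * aperyTerm n k := by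
  have h1 := choose_succ_left_int n k
  have h2 := choose_succ_left_int (n + k) k
  push_cast at h2
  simp only [aperyTerm, add_right_comm n 1 k]
  refine mul_left_cancel₀ (show ((n : ℤ) + 1) ≠ 0 by positivity) ?_
  linear_combination ((n : ℤ) + 1) * ((n + k + 1).choose k) * h1
    + ((n.choose k : ℤ) * (n + 1)) * h2

theorem aperyTerm_succ_succ (n k : ℕ) :
    ((k : ℤ) + 1) ^ 2 * aperyTerm (n + 1) (k + 1) = (n + k + 1) * (n + k + 2) * aperyTerm n k := by
  have h1 := aperyTerm_succ_right (n + 1) k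
  have h2 := aperyTerm_succ_left n k
  push_cast at h1
  linear_combination h1 + ((n : ℤ) + k + 2) * h2

/-- Moves row n to row n+1, in which the telescoping certificate is written. -/
theorem aperyTerm_succ_right' (n k : ℕ) :
    ((k : ℤ) + 1) ^ 2 * aperyTerm n (k + 1) = (n - k) * (n + 1 - k) * aperyTerm (n + 1) k := by
  linear_combination aperyTerm_succ_right n k - ((n : ℤ) - k) * aperyTerm_succ_left n k

theorem aperyNumber_eq_sum {n N : ℕ} (h : n < N) :
    (aperyNumber n : ℤ) = ∑ k ∈ Finset.range N, aperyTerm n k ^ 2 := by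
  rw [aperyNumber]
  push_cast
  rw [Finset.sum_congr rfl fun k _ => (mul_pow (n.choose k : ℤ) ((n + k).choose k : ℤ) 2).symm]
  refine Finset.sum_subset (Finset.range_subset_range.2 h) fun k _ hk => ?_
  have := aperyTerm_eq_zero (n := n) (k := k) (by simpa using hk)
  rw [aperyTerm] at this
  rw [this]; rfl

/-- Zeilberger's telescoping certificate for the Apéry recurrence. -/
theorem sum_aperyTerm_recurrence (n K : ℕ) :
    ∑ k ∈ Finset.range (K + 1), (((n : ℤ) + 2) ^ 3 * aperyTerm (n + 2) k ^ 2
      - (2 * n + 3) * (17 * (n + 1) ^ 2 + 17 * (n + 1) + 5) * aperyTerm (n + 1) k ^ 2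
      + (n + 1) ^ 3 * aperyTerm n k ^ 2)
    = 4 * (2 * n + 3) * (K * (2 * K + 1) - (2 * n + 3) ^ 2) * aperyTerm (n + 1) K ^ 2 := by
  induction K with
  | zero =>
    simp only [zero_add, Finset.sum_range_one, aperyTerm_zero_right]
    push_cast
    ring
  | succ j ih =>
    rw [Finset.sum_range_succ, ih]
    have h1 := aperyTerm_succ_succ (n + 1) j
    have h2 := aperyTerm_succ_right (n + 1) j
    have h3 := aperyTerm_succ_right' n j
    push_cast at h1 h2 ⊢
    have sq {a b c : ℤ} (h : a * b = c) : a ^ 2 * b ^ 2 = c ^ 2 := by rw [← h]; ring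
    refine mul_left_cancel₀ (show (((j : ℤ) + 1) ^ 2) ^ 2 ≠ 0 by positivity) ?_
    linear_combination ((n : ℤ) + 2) ^ 3 * sq h1
      + (-(2 * (n : ℤ) + 3) * (17 * (n + 1) ^ 2 + 17 * (n + 1) + 5)
        - 4 * (2 * n + 3) * ((j + 1) * (2 * (j + 1) + 1) - (2 * n + 3) ^ 2)) * sq h2
      + ((n : ℤ) + 1) ^ 3 * sq h3

theorem aperyNumber_recurrence (n : ℕ) :
    ((n : ℤ) + 2) ^ 3 * aperyNumber (n + 2)
      - (2 * n + 3) * (17 * (n + 1) ^ 2 + 17 * (n + 1) + 5) * aperyNumber (n + 1)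
      + (n + 1) ^ 3 * aperyNumber n = 0 := by
  -- The range reaches past row n+1, so the boundary term vanishes.
  have h := sum_aperyTerm_recurrence n (n + 2)
  rw [aperyTerm_eq_zero (Nat.lt_succ_self (n + 1)), Finset.sum_add_distrib,
    Finset.sum_sub_distrib, ← Finset.mul_sum, ← Finset.mul_sum, ← Finset.mul_sum,
    ← aperyNumber_eq_sum (by omega), ← aperyNumber_eq_sum (by omega),
    ← aperyNumber_eq_sum (by omega)] at h
  simpa using h

/-- Summation by parts: the adjoint of the Apéry recurrence operator, applied to any `x`,
gives a telescoping sum against the Apéry numbers. -/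
theorem sum_adjoint_mul_aperyNumber (x : ℤ → ℤ) (N : ℕ) :
    ∑ n ∈ Finset.range (N + 1), ((n : ℤ) ^ 3 * x (n - 1) + (n + 1) ^ 3 * x (n + 1)
      - (2 * n + 1) * (17 * n ^ 2 + 17 * n + 5) * x n) * aperyNumber n
    = ((N : ℤ) + 1) ^ 3 * (x (N + 1) * aperyNumber N - x N * aperyNumber (N + 1)) := by
  induction N with
  | zero =>
    have h0 : aperyNumber 0 = 1 := by decide
    have h1 : aperyNumber 1 = 5 := by decide
    simp [h0, h1]
    ring
  | succ N ih =>
    rw [Finset.sum_range_succ, ih]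
    have h := aperyNumber_recurrence N
    push_cast
    rw [add_sub_cancel_right]
    linear_combination x (N + 1) * h

/-! ### Reduction of the exponent -/

theorem sum_range_two_mul {M : Type*} [AddCommMonoid M] (f : ℕ → M) (n : ℕ) :
    ∑ i ∈ Finset.range (2 * n), f i = ∑ i ∈ Finset.range n, (f (2 * i) + f (2 * i + 1)) := by
  induction n with
  | zero => simp
  | succ n ih =>
    rw [Finset.sum_range_succ, ← ih, Nat.mul_succ, Finset.sum_range_succ, Finset.sum_range_succ,
      add_assoc]

open Polynomial in
-- The left side is g(m) - g(-m) for a monic g of degree 2d+3, so only odd powers survive, doubled.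
theorem exists_odd_expansion (d : ℕ) : ∃ a : ℕ → ℤ, ∀ m : ℤ,
    (m + 1) ^ 3 * (m + 2) ^ (2 * d) + (m - 1) ^ 3 * (m - 2) ^ (2 * d)
    = 2 * m ^ (2 * d + 3) + 2 * ∑ i ∈ Finset.range (d + 1), a i * m ^ (2 * i + 1) := by
  let g : ℤ[X] := (X + C 1) ^ 3 * (X + C 2) ^ (2 * d)
  have hm1 : ((X + C 1 : ℤ[X]) ^ 3).Monic := (monic_X_add_C 1).pow 3
  have hm2 : ((X + C 2 : ℤ[X]) ^ (2 * d)).Monic := (monic_X_add_C 2).pow (2 * d)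
  have hg : g.Monic := hm1.mul hm2
  have hdeg : g.natDegree = 2 * d + 3 := by
    rw [hm1.natDegree_mul hm2, (monic_X_add_C _).natDegree_pow, (monic_X_add_C _).natDegree_pow,
      natDegree_X_add_C, natDegree_X_add_C]
    ring
  have hev (m : ℤ) : g.eval m = ∑ i ∈ Finset.range (d + 2),
      (g.coeff (2 * i) * m ^ (2 * i) + g.coeff (2 * i + 1) * m ^ (2 * i + 1)) := by
    rw [eval_eq_sum_range' (n := 2 * (d + 2)) (by omega),
      sum_range_two_mul fun i => g.coeff i * m ^ i]
  refine ⟨fun i => g.coeff (2 * i + 1), fun m => ?_⟩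
  have h1 : (m + 1) ^ 3 * (m + 2) ^ (2 * d) + (m - 1) ^ 3 * (m - 2) ^ (2 * d)
      = g.eval m - g.eval (-m) := by
    have : (m - 2) ^ (2 * d) = (-m + 2) ^ (2 * d) := by
      rw [pow_mul, pow_mul]; congr 1; ring
    simp only [g, eval_mul, eval_pow, eval_add, eval_X, eval_C, this]
    ring
  have hlead : g.coeff (2 * (d + 1) + 1) = 1 := by
    have := hg.coeff_natDegree
    rwa [hdeg] at this
  rw [h1, hev, hev, ← Finset.sum_sub_distrib]
  have h2 (i : ℕ) : g.coeff (2 * i) * m ^ (2 * i) + g.coeff (2 * i + 1) * m ^ (2 * i + 1)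
      - (g.coeff (2 * i) * (-m) ^ (2 * i) + g.coeff (2 * i + 1) * (-m) ^ (2 * i + 1))
      = 2 * (g.coeff (2 * i + 1) * m ^ (2 * i + 1)) := by
    rw [(even_two_mul i).neg_pow, (odd_two_mul_add_one i).neg_pow]
    ring
  rw [Finset.sum_congr rfl fun i _ => h2 i, ← Finset.mul_sum, Finset.sum_range_succ, hlead]
  ring

/-- The sum of the Apéry numbers below `N` weighted by `(2 * k + 1) ^ (2 * r + 1)`. -/
def oddPowerAperySum (r N : ℕ) : ℤ :=
  ∑ k ∈ Finset.range N, (2 * (k : ℤ) + 1) ^ (2 * r + 1) * aperyNumber k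

theorem exists_oddPowerAperySum_reduction (d : ℕ) : ∃ a : ℕ → ℤ, ∀ N : ℕ,
    (N : ℤ) ^ 3 ∣ 16 * oddPowerAperySum (d + 1) N
      - ∑ i ∈ Finset.range (d + 1), a i * oddPowerAperySum i N := by
  obtain ⟨a, ha⟩ := exists_odd_expansion d
  -- With m = 2n+1, the middle coefficient of the recurrence is (17m^3 + 3m)/4. The leading
  -- coefficient of the weight is 2/8 - 17/4 = -4; scaling by -4 gives 16 and clears denominators.
  refine ⟨fun i => a i - if i = d then 3 else 0, fun N => ?_⟩
  rcases N with _ | N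
  · simp [oddPowerAperySum]
  have h := sum_adjoint_mul_aperyNumber (fun n => (2 * n + 1) ^ (2 * d)) N
  refine ⟨-4 * ((fun n : ℤ => (2 * n + 1) ^ (2 * d)) (N + 1) * aperyNumber N
    - (fun n : ℤ => (2 * n + 1) ^ (2 * d)) N * aperyNumber (N + 1)), ?_⟩
  have key : 16 * oddPowerAperySum (d + 1) (N + 1)
      - ∑ i ∈ Finset.range (d + 1), (a i - if i = d then 3 else 0) * oddPowerAperySum i (N + 1)
      = -4 * ∑ n ∈ Finset.range (N + 1),
        ((n : ℤ) ^ 3 * (2 * ((n : ℤ) - 1) + 1) ^ (2 * d)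
          + (n + 1) ^ 3 * (2 * ((n : ℤ) + 1) + 1) ^ (2 * d)
        - (2 * n + 1) * (17 * n ^ 2 + 17 * n + 5) * (2 * (n : ℤ) + 1) ^ (2 * d))
        * aperyNumber n := by
    simp only [oddPowerAperySum, Finset.mul_sum]
    rw [Finset.sum_comm, ← Finset.sum_sub_distrib]
    refine Finset.sum_congr rfl fun n _ => ?_
    have hn := ha (2 * n + 1)
    have h3 : ∑ i ∈ Finset.range (d + 1), (a i - if i = d then 3 else 0) *
        ((2 * (n : ℤ) + 1) ^ (2 * i + 1) * aperyNumber n)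
        = (∑ i ∈ Finset.range (d + 1), a i * (2 * (n : ℤ) + 1) ^ (2 * i + 1)) * aperyNumber n
          - 3 * (2 * (n : ℤ) + 1) ^ (2 * d + 1) * aperyNumber n := by
      simp only [sub_mul, Finset.sum_sub_distrib, ite_mul, zero_mul, Finset.sum_ite_eq',
        Finset.mem_range, Nat.lt_succ_self, if_true, Finset.sum_mul, mul_assoc]
    rw [h3]
    refine mul_left_cancel₀ (two_ne_zero (α := ℤ)) ?_
    have e1 : 2 * ((n : ℤ) - 1) + 1 = 2 * n + 1 - 2 := by ring
    have e2 : 2 * ((n : ℤ) + 1) + 1 = 2 * n + 1 + 2 := by ring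
    rw [e1, e2]
    linear_combination (aperyNumber n : ℤ) * hn
  rw [key]
  push_cast
  rw [h]
  ring

theorem exists_oddPowerAperySum_congr (r : ℕ) : ∃ e : ℤ, ∀ N : ℕ,
    16 ^ r * oddPowerAperySum r N ≡ e * oddPowerAperySum 0 N [ZMOD (N : ℤ) ^ 3] := by
  induction r using Nat.strong_induction_on with
  | _ r ih =>
    rcases r with _ | d
    · exact ⟨1, fun N => by simp⟩
    choose! e he using ih
    obtain ⟨a, ha⟩ := exists_oddPowerAperySum_reduction d
    refine ⟨∑ i ∈ Finset.range (d + 1), a i * 16 ^ (d - i) * e i, fun N => ?_⟩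
    have h1 : ∑ i ∈ Finset.range (d + 1), a i * oddPowerAperySum i N
        ≡ 16 * oddPowerAperySum (d + 1) N [ZMOD (N : ℤ) ^ 3] :=
      (Int.modEq_iff_dvd).2 (ha N)
    calc 16 ^ (d + 1) * oddPowerAperySum (d + 1) N
        = 16 ^ d * (16 * oddPowerAperySum (d + 1) N) := by ring
      _ ≡ 16 ^ d * ∑ i ∈ Finset.range (d + 1), a i * oddPowerAperySum i N [ZMOD (N : ℤ) ^ 3] :=
          h1.symm.mul_left _
      _ = ∑ i ∈ Finset.range (d + 1), a i * 16 ^ (d - i) * (16 ^ i * oddPowerAperySum i N) := by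
          rw [Finset.mul_sum]
          refine Finset.sum_congr rfl fun i hi => ?_
          have : (16 : ℤ) ^ d = 16 ^ (d - i) * 16 ^ i := by
            rw [← pow_add, Nat.sub_add_cancel (Nat.lt_succ_iff.1 (Finset.mem_range.1 hi))]
          rw [this]
          ring
      _ ≡ ∑ i ∈ Finset.range (d + 1), a i * 16 ^ (d - i) * (e i * oddPowerAperySum 0 N)
            [ZMOD (N : ℤ) ^ 3] :=
          Int.ModEq.sum fun i hi => (he i (Finset.mem_range.1 hi) N).mul_left _
      _ = (∑ i ∈ Finset.range (d + 1), a i * 16 ^ (d - i) * e i) * oddPowerAperySum 0 N := by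
          rw [Finset.sum_mul]
          exact Finset.sum_congr rfl fun i _ => by ring

/-! ### The case r = 0 -/

theorem sum_odd_mul_aperyTerm_sq (n k : ℕ) :
    (2 * (k : ℤ) + 1) * ∑ m ∈ Finset.range n, (2 * (m : ℤ) + 1) * aperyTerm m k ^ 2
      = ((n - k) * aperyTerm n k) ^ 2 := by
  induction n with
  | zero =>
    rcases k with _ | k
    · simp
    · simp [aperyTerm_eq_zero (Nat.succ_pos k)]
  | succ n ih =>
    rw [Finset.sum_range_succ, mul_add, ih]
    push_cast
    rw [aperyTerm_succ_left]
    ring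

theorem oddPowerAperySum_zero (N : ℕ) : oddPowerAperySum 0 N
    = ∑ k ∈ Finset.range N, ∑ m ∈ Finset.range N, (2 * (m : ℤ) + 1) * aperyTerm m k ^ 2 := by
  rw [Finset.sum_comm, oddPowerAperySum]
  refine Finset.sum_congr rfl fun m hm => ?_
  rw [aperyNumber_eq_sum (Finset.mem_range.1 hm), ← Finset.mul_sum]
  simp

theorem prime_not_dvd_succ {p k : ℕ} (h : k + 1 < p) : ¬ (p : ℤ) ∣ (k : ℤ) + 1 := by
  intro hd
  have := Nat.le_of_dvd k.succ_pos (by exact_mod_cast hd)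
  omega

/-- Here v is the product of (p^2 - j^2)/j^2 over 1 ≤ j ≤ k, which is ±1 mod p^2. -/
theorem exists_sub_mul_aperyTerm_eq {p : ℕ} (hp : p.Prime) {k : ℕ} (hk : k < p) :
    ∃ v : ℤ, ((p : ℤ) - k) * aperyTerm p k = p * v ∧ (p : ℤ) ^ 2 ∣ v ^ 2 - 1 := by
  have hp' : Prime (p : ℤ) := Nat.prime_iff_prime_int.1 hp
  induction k with
  | zero => exact ⟨1, by simp [aperyTerm_zero_right]⟩
  | succ k ih =>
    obtain ⟨v, hv, hdvd⟩ := ih (by omega)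
    have hnd := prime_not_dvd_succ hk
    have h1 := aperyTerm_succ_right p k
    have h2 : ((k : ℤ) + 1) ^ 2 * (((p : ℤ) - (k + 1)) * aperyTerm p (k + 1))
        = p * (((p : ℤ) ^ 2 - (k + 1) ^ 2) * v) := by
      linear_combination ((p : ℤ) - (k + 1)) * h1 + ((p : ℤ) ^ 2 - (k + 1) ^ 2) * hv
    obtain ⟨w, hw⟩ := hp'.pow_dvd_of_dvd_mul_left 1 (fun h => hnd (hp'.dvd_of_dvd_pow h))
      (show (p : ℤ) ^ 1 ∣ ((k : ℤ) + 1) ^ 2 * (((p : ℤ) - (k + 1)) * aperyTerm p (k + 1)) from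
        by rw [h2, pow_one]; exact dvd_mul_right _ _)
    rw [pow_one] at hw
    refine ⟨w, by push_cast; exact hw, ?_⟩
    have h3 : ((k : ℤ) + 1) ^ 2 * w = ((p : ℤ) ^ 2 - (k + 1) ^ 2) * v := by
      refine mul_left_cancel₀ hp'.ne_zero ?_
      rw [← h2, hw]
      ring
    have h4 : ((k : ℤ) + 1) ^ 4 * (w ^ 2 - 1) = (p : ℤ) ^ 2 * ((p ^ 2 - 2 * (k + 1) ^ 2) * v ^ 2)
        + ((k : ℤ) + 1) ^ 4 * (v ^ 2 - 1) := by
      linear_combination (((k : ℤ) + 1) ^ 2 * w + ((p : ℤ) ^ 2 - (k + 1) ^ 2) * v) * h3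
    refine hp'.pow_dvd_of_dvd_mul_left (a := ((k : ℤ) + 1) ^ 4) 2
      (fun h => hnd (hp'.dvd_of_dvd_pow h)) ?_
    rw [h4]
    exact dvd_add (dvd_mul_right _ _) (hdvd.mul_left _)

theorem oddPowerAperySum_zero_congr {p : ℕ} (hp : p.Prime) (h2 : p ≠ 2) :
    (p : ℤ) ^ 3 ∣ oddPowerAperySum 0 p - p := by
  have hp' : Prime (p : ℤ) := Nat.prime_iff_prime_int.1 hp
  obtain ⟨h, hh⟩ := hp.odd_of_ne_two h2
  have hp2 : ¬ (p : ℤ) ∣ 2 := fun hd =>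
    h2 ((Nat.prime_dvd_prime_iff_eq hp Nat.prime_two).1 (by exact_mod_cast hd))
  set s : ℕ → ℤ := fun k => ∑ m ∈ Finset.range p, (2 * (m : ℤ) + 1) * aperyTerm m k ^ 2 with hs
  have hsv (k : ℕ) (hk : k < p) : ∃ u : ℤ, (2 * (k : ℤ) + 1) * s k = p ^ 2 * (1 + p ^ 2 * u) := by
    obtain ⟨v, hv, u, hu⟩ := exists_sub_mul_aperyTerm_eq hp hk
    refine ⟨u, ?_⟩
    rw [hs, sum_odd_mul_aperyTerm_sq, hv]
    linear_combination (p : ℤ) ^ 2 * hu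
  have hS : oddPowerAperySum 0 p = ∑ k ∈ Finset.range p, s k := oddPowerAperySum_zero p
  refine hp'.pow_dvd_of_dvd_mul_left 3 hp2 ?_
  -- Doubling pairs k with p-1-k, whose odd factors 2k+1 sum to 2p; k = h is its own partner and
  -- absorbs the 2p.
  have hsum : 2 * (oddPowerAperySum 0 p - p)
      = ∑ k ∈ Finset.range p, (s k + s (p - 1 - k) - if k = h then 2 * (p : ℤ) else 0) := by
    rw [Finset.sum_sub_distrib, Finset.sum_add_distrib, Finset.sum_range_reflect, ← hS,
      Finset.sum_ite_eq', if_pos (Finset.mem_range.2 (by omega))]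
    ring
  rw [hsum]
  refine Finset.dvd_sum fun k hk => ?_
  rw [Finset.mem_range] at hk
  obtain ⟨u, hu⟩ := hsv k hk
  split_ifs with hkh
  · have e : p - 1 - k = k := by omega
    have e' : 2 * (k : ℤ) + 1 = p := by rw [hh, hkh]; push_cast; ring
    rw [e' ] at hu
    have : s k = p * (1 + p ^ 2 * u) := mul_left_cancel₀ hp'.ne_zero (by rw [hu]; ring)
    rw [e, this]
    exact ⟨2 * u, by ring⟩
  · obtain ⟨u', hu'⟩ := hsv (p - 1 - k) (by omega)
    have e : ((p - 1 - k : ℕ) : ℤ) = p - 1 - k := by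
      rw [Nat.sub_sub, Nat.cast_sub (by omega)]; push_cast; ring
    have ndvd (j : ℕ) (hj : j < p) (hjh : j ≠ h) : ¬ (p : ℤ) ∣ 2 * (j : ℤ) + 1 := by
      rintro hd
      have hd' : p ∣ 2 * j + 1 := by exact_mod_cast hd
      obtain ⟨q, hq⟩ := hd'
      have hq2 : q < 2 := by
        by_contra! hcon
        nlinarith
      interval_cases q <;> omega
    have hdv : (p : ℤ) ^ 2 ∣ s (p - 1 - k) :=
      hp'.pow_dvd_of_dvd_mul_left 2 (ndvd (p - 1 - k) (by omega) (by omega)) (by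
        rw [hu']; exact dvd_mul_right _ _)
    obtain ⟨w, hw⟩ := hdv
    rw [sub_zero]
    refine hp'.pow_dvd_of_dvd_mul_left 3 (ndvd k hk hkh) ⟨2 * w + p * u - p * u', ?_⟩
    rw [e] at hu'
    linear_combination hu - hu' + 2 * (p : ℤ) * hw

theorem mainTheorem2 (r : ℕ) :
    ∃ c : ℚ, (∃ m : ℕ, c.den = 2 ^ m) ∧
      ∀ (p : ℕ) [Fact p.Prime], 3 < p →
        ∃ cp : ℤ_[p], (cp : ℚ_[p]) = (c : ℚ_[p]) ∧
          (p : ℤ_[p]) ^ 3 ∣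
            (∑ k ∈ Finset.range p,
              (2 * (k : ℤ_[p]) + 1) ^ (2 * r + 1) * (aperyNumber k : ℤ_[p])) - cp * (p : ℤ_[p]) := by
  obtain ⟨e, he⟩ := exists_oddPowerAperySum_congr r
  refine ⟨(e : ℚ) / ((16 ^ r : ℤ) : ℚ), ?_, fun p hpF hp3 => ?_⟩
  · have h1 : (((e : ℚ) / ((16 ^ r : ℤ) : ℚ)).den : ℤ) ∣ 16 ^ r := by
      rw [← Rat.divInt_eq_div]
      exact Rat.den_dvd e (16 ^ r)
    have h2 : ((e : ℚ) / ((16 ^ r : ℤ) : ℚ)).den ∣ 2 ^ (4 * r) := by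
      rw [pow_mul]
      exact_mod_cast h1
    obtain ⟨m, -, hm⟩ := (Nat.dvd_prime_pow Nat.prime_two).1 h2
    exact ⟨m, hm⟩
  · have hp : p.Prime := hpF.out
    have hu : IsUnit ((16 : ℤ_[p]) ^ r) := by
      refine IsUnit.pow r ?_
      have hc : Nat.Coprime p 16 := by
        refine (Nat.Prime.coprime_iff_not_dvd hp).2 fun hd => ?_
        have := (Nat.prime_dvd_prime_iff_eq hp Nat.prime_two).1
          (hp.dvd_of_dvd_pow (show p ∣ 2 ^ 4 by simpa using hd))
        omega
      rw [PadicInt.isUnit_iff]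
      exact_mod_cast PadicInt.norm_natCast_eq_one_iff.2 hc
    obtain ⟨u, hu⟩ := hu
    refine ⟨e * ↑u⁻¹, ?_, ?_⟩
    · have h1 : ((↑u⁻¹ : ℤ_[p]) : ℚ_[p]) * 16 ^ r = 1 := by
        have : (↑u⁻¹ : ℤ_[p]) * 16 ^ r = 1 := by rw [← hu, Units.inv_mul]
        exact_mod_cast congrArg (fun z : ℤ_[p] => (z : ℚ_[p])) this
      push_cast
      rw [eq_div_iff (pow_ne_zero r (by norm_num)), mul_assoc, h1, mul_one]
    · have h1 : (p : ℤ) ^ 3 ∣ 16 ^ r * oddPowerAperySum r p - e * p := by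
        have h2 := (he p).symm.dvd
        have h3 := (oddPowerAperySum_zero_congr hp (by omega)).mul_left e
        have := dvd_add h2 h3
        ring_nf at this ⊢
        exact this
      have h2 := map_dvd (Int.castRingHom ℤ_[p]) h1
      simp only [oddPowerAperySum, eq_intCast, Int.cast_pow, Int.cast_natCast, Int.cast_sub,
        Int.cast_mul, Int.cast_sum, Int.cast_add, Int.cast_one, Int.cast_ofNat] at h2
      rw [← hu] at h2
      have h3 := h2.mul_left (↑u⁻¹ : ℤ_[p])
      rw [mul_sub, Units.inv_mul_cancel_left] at h3
      convert h3 using 2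
      ring
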